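/- An overpartition of $n$ is a partition of $n$ in which the last occurrence of each part size may be overlined (so every size has at most one overlined occurrence). For an overpartition $\pi$, let $\overline{mex}_{2,1}(\pi)$ be the smallest positive odd integer that is not a non-overlined part of $\pi$. For integers $n\ge 1$ and $k\ge 0$, let $op_{2,1}(n,k)$ be the number of overpartitions $\pi$ of $n$ with $\overline{mex}_{2,1}(\pi)\ge 2k+1$ and $\overline{mex}_{2,1}(\pi)\equiv 2k+1 \pmod 4$. For $n,k\ge 1$: - let $\overline{M}_k(n)$ be the number of overpartitions of $n$ that have at least one part larger than $k$ and in which the smallest part size larger than $k$ appears at least $k+1$ times (overlined and non-overlined occurrences both counted); - let $\overline{N}_k(n)$ be the number of overpartitions of $n$ such that, once the overlined part $\overline{k}$ is disregarded (it may be present or absent), there is a part of size larger than $k-1$, and the smallest part size larger than $k-1$ appears exactly $k$ times and has no overlined occurrence. Then for all integers $n,k\ge 1$, $$op_{2,1}(n,k+1)=\frac{\overline{M}_k(n)}{2}\qquad\text{and}\qquad op_{2,1}(n,k)-op_{2,1}(n,k+1)=\overline{N}_k(n).$$ -/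

import Mathlib

/-- An overpartition of `n`: a partition of `n` in which one occurrence (by convention the last)
of each part size may be overlined. It is recorded by the multiset `plain` of its non-overlined
parts and the finite set `overlined` of the sizes of its overlined parts. -/
@[ext]
structure Overpartition (n : ℕ) where
  plain : Multiset ℕ
  overlined : Finset ℕ
  plain_pos : ∀ m ∈ plain, 0 < m
  overlined_pos : ∀ m ∈ overlined, 0 < m
  sum_eq : plain.sum + ∑ m ∈ overlined, m = n

namespace Overpartition

/-- The partition of `n` obtained by forgetting the overlines. -/
def toPartition {n : ℕ} (π : Overpartition n) : n.Partition where
  parts := π.plain + π.overlined.val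
  parts_pos := by
    intro i hi
    rcases Multiset.mem_add.mp hi with h | h
    · exact π.plain_pos i h
    · exact π.overlined_pos i h
  parts_sum := by
    have h := π.sum_eq
    rw [Finset.sum_eq_multiset_sum, Multiset.map_id'] at h
    rw [Multiset.sum_add, h]

/-- There are only finitely many overpartitions of `n`, so that the cardinalities below are
genuine. -/
instance instFinite (n : ℕ) : Finite (Overpartition n) := by
  have hle : ∀ (π : Overpartition n), ∀ m ∈ π.overlined, m < n + 1 := by
    intro π m hm
    have h1 : m ≤ ∑ i ∈ π.overlined, i :=
      Finset.single_le_sum (f := fun i => i) (fun i _ => Nat.zero_le i) hm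
    have h2 := π.sum_eq
    omega
  let f : Overpartition n → n.Partition × (Finset.range (n + 1)).powerset := fun π =>
    (π.toPartition, ⟨π.overlined, Finset.mem_powerset.mpr
      (fun m hm => Finset.mem_range.mpr (hle π m hm))⟩)
  refine Finite.of_injective f ?_
  intro π ρ h
  have h1 : π.toPartition = ρ.toPartition := congrArg Prod.fst h
  have h2 : π.overlined = ρ.overlined := congrArg (fun x => (x.2 : Finset ℕ)) h
  have h3 : π.plain + π.overlined.val = ρ.plain + ρ.overlined.val :=
    congrArg Nat.Partition.parts h1
  rw [h2] at h3
  exact Overpartition.ext (add_right_cancel h3) h2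

/-- The number of times a part of size `m` appears in `π`, overlined or not. -/
def mult {n : ℕ} (π : Overpartition n) (m : ℕ) : ℕ :=
  π.toPartition.parts.count m

/-- The smallest positive integer congruent to `a` modulo `A` that is not a non-overlined part
of `π`. -/
noncomputable def mex {n : ℕ} (A a : ℕ) (π : Overpartition n) : ℕ :=
  sInf {m : ℕ | 0 < m ∧ m ≡ a [MOD A] ∧ m ∉ π.plain}

/-- For a positive modulus the set defining `mex` is nonempty, so `mex` is its least element. -/
theorem isLeast_mex {n A : ℕ} (hA : 0 < A) (a : ℕ) (π : Overpartition n) :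
    IsLeast {m : ℕ | 0 < m ∧ m ≡ a [MOD A] ∧ m ∉ π.plain} (mex A a π) := by
  have hne : {m : ℕ | 0 < m ∧ m ≡ a [MOD A] ∧ m ∉ π.plain}.Nonempty := by
    have hn : n + 1 ≤ A * (n + 1) := Nat.le_mul_of_pos_left _ hA
    refine ⟨a + A * (n + 1), by omega, by simp [Nat.ModEq], fun hm => ?_⟩
    have h1 := Multiset.le_sum_of_mem hm
    have h2 := π.sum_eq
    omega
  exact ⟨Nat.sInf_mem hne, fun m hm => Nat.sInf_le hm⟩

/-- `op21 n k` is the number of overpartitions of `n` whose minimal excludant `mex 2 1`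
is at least `2k+1` and is congruent to `2k+1` modulo `4`. -/
noncomputable def op21 (n k : ℕ) : ℕ :=
  Nat.card {π : Overpartition n // 2 * k + 1 ≤ mex 2 1 π ∧ mex 2 1 π ≡ 2 * k + 1 [MOD 4]}

/-- `Mbar k n` is the number of overpartitions of `n` that have a part larger than `k` and in
which the first (that is, smallest) part size `s` larger than `k` appears at least `k + 1` times,
overlined or not. -/
noncomputable def Mbar (k n : ℕ) : ℕ :=
  Nat.card {π : Overpartition n //
    ∃ s, IsLeast {m : ℕ | k < m ∧ m ∈ π.toPartition.parts} s ∧ k + 1 ≤ π.mult s}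

/-- `Nbar k n` is the number of overpartitions of `n` in which, an overlined part of size `k`
being allowed and disregarded, there is a part of size at least `k`, and the smallest such size
`s` appears exactly `k` times, without overlined occurrence. Its generating function is
`(-q;q)_k / (q;q)_{k-1} * ∑_{s ≥ k} q^{k s} (-q^{s+1};q)_∞ / (q^{s+1};q)_∞`. -/
noncomputable def Nbar (k n : ℕ) : ℕ :=
  Nat.card {π : Overpartition n //
    ∃ s, IsLeast {m : ℕ | k ≤ m ∧ (m ∈ π.plain ∨ m ∈ π.overlined.erase k)} s ∧
      π.plain.count s = k ∧ s ∉ π.overlined.erase k}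

end Overpartition

/-! Write a_k for the number of overpartitions of n with at least k plain parts equal to k
(`plainSquareCount n k`). Everything follows from three linear relations. (1) op(k) + op(k+1) = a_k
for k ≥ 1 (`op21_add_op21_succ`): the mex is at least 2k+1 exactly when 1, 3, ..., 2k-1 are all
plain parts, and these sum to k², as do k copies of k. (2) M_k + N_k = a_k for k ≥ 1
(`Mbar_add_Nbar`). (3) M_k = a_{k+1} + N_{k+1} (`Mbar_eq`). By (2) and (3), M_k + M_{k+1} =
2a_{k+1}. By (1), 2op(k+1) satisfies the same recurrence. Both vanish for k ≥ n, so descending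
induction gives 2op(k+1) = M_k. Then op(k) - op(k+1) = a_k - 2op(k+1) = a_k - M_k = N_k. The
bijections behind (1)–(3) all remove some parts and insert others of equal total; `card_eq_of_trade`
treats them uniformly. -/

namespace Overpartition

variable {n : ℕ}

/-- The number of non-overlined parts of size `m`. -/
def plainCount (π : Overpartition n) (m : ℕ) : ℕ := π.plain.count m

/-- The number, `0` or `1`, of overlined parts of size `m`. -/
def overCount (π : Overpartition n) (m : ℕ) : ℕ := π.overlined.val.count m

theorem overCount_le_one (π : Overpartition n) (m : ℕ) : π.overCount m ≤ 1 :=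
  Multiset.nodup_iff_count_le_one.mp π.overlined.nodup m

theorem mem_plain_iff (π : Overpartition n) (m : ℕ) : m ∈ π.plain ↔ π.plainCount m ≠ 0 :=
  Multiset.count_ne_zero.symm

theorem mem_overlined_iff (π : Overpartition n) (m : ℕ) :
    m ∈ π.overlined ↔ π.overCount m ≠ 0 := by
  rw [overCount, Multiset.count_ne_zero, Finset.mem_val]

theorem mem_parts_iff (π : Overpartition n) (m : ℕ) :
    m ∈ π.toPartition.parts ↔ π.plainCount m ≠ 0 ∨ π.overCount m ≠ 0 := by
  rw [← mem_plain_iff, ← mem_overlined_iff]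
  exact Multiset.mem_add

theorem mult_eq (π : Overpartition n) (m : ℕ) : π.mult m = π.plainCount m + π.overCount m :=
  Multiset.count_add _ _ _

theorem mul_plainCount_le (π : Overpartition n) (m : ℕ) : m * π.plainCount m ≤ n := by
  have h : Multiset.replicate (π.plainCount m) m ≤ π.plain :=
    Multiset.le_count_iff_replicate_le.mp le_rfl
  obtain ⟨r, hr⟩ := Multiset.le_iff_exists_add.mp h
  have h2 := π.sum_eq
  rw [hr, Multiset.sum_add, Multiset.sum_replicate, smul_eq_mul, mul_comm] at h2
  omega

/-! ### Trading parts -/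

/-- `π` has no part, overlined or not, in the interval `[a, b)`. -/
def Gap (π : Overpartition n) (a b : ℕ) : Prop :=
  ∀ m, a ≤ m → m < b → π.plainCount m = 0 ∧ π.overCount m = 0

/-- `ρ` arises from `π` by trading the plain parts `S` for `T` and the overlined parts `U`
for `V`. -/
structure Trade (S T U V : Multiset ℕ) (π ρ : Overpartition n) : Prop where
  plain : ∀ m, ρ.plainCount m + S.count m = π.plainCount m + T.count m
  marked : ∀ m, ρ.overCount m + U.count m = π.overCount m + V.count m

variable {S T U V : Multiset ℕ} {π ρ : Overpartition n}

theorem Trade.symm (h : Trade S T U V π ρ) : Trade T S V U ρ π :=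
  ⟨fun m => (h.plain m).symm, fun m => (h.marked m).symm⟩

theorem Trade.right_unique {ρ' : Overpartition n} (h : Trade S T U V π ρ)
    (h' : Trade S T U V π ρ') : ρ = ρ' := by
  apply Overpartition.ext
  · refine Multiset.ext.mpr fun m => ?_
    have h1 := h.plain m
    have h2 := h'.plain m
    simp only [plainCount] at h1 h2
    omega
  · refine Finset.val_injective (Multiset.ext.mpr fun m => ?_)
    have h1 := h.marked m
    have h2 := h'.marked m
    simp only [overCount] at h1 h2
    omega

theorem exists_trade (hS : ∀ m, S.count m ≤ π.plainCount m) (hU : ∀ m, U.count m ≤ π.overCount m)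
    (hV : ∀ m, π.overCount m + V.count m ≤ 1 + U.count m) (hT0 : 0 ∉ T) (hV0 : 0 ∉ V)
    (hsum : S.sum + U.sum = T.sum + V.sum) : ∃ ρ : Overpartition n, Trade S T U V π ρ := by
  obtain ⟨P, hP⟩ := Multiset.le_iff_exists_add.mp (Multiset.le_iff_count.mpr hS)
  obtain ⟨O, hO⟩ := Multiset.le_iff_exists_add.mp (Multiset.le_iff_count.mpr hU)
  -- `hV` is what keeps each size overlined at most once after the trade.
  have hnd : (O + V).Nodup := by
    refine Multiset.nodup_iff_count_le_one.mpr fun m => ?_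
    have := hV m
    rw [overCount, hO, Multiset.count_add] at this
    rw [Multiset.count_add]
    omega
  refine ⟨⟨P + T, ⟨O + V, hnd⟩, ?_, ?_, ?_⟩, ?_, ?_⟩
  · intro m hm
    rcases Multiset.mem_add.mp hm with h | h
    · exact π.plain_pos m (hP ▸ Multiset.mem_add.mpr (Or.inr h))
    · exact Nat.pos_of_ne_zero fun h0 => hT0 (h0 ▸ h)
  · intro m hm
    rcases Multiset.mem_add.mp (Finset.mem_mk.mp hm) with h | h
    · exact π.overlined_pos m (Finset.mem_val.mp (hO ▸ Multiset.mem_add.mpr (Or.inr h)))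
    · exact Nat.pos_of_ne_zero fun h0 => hV0 (h0 ▸ h)
  · have h := π.sum_eq
    rw [Finset.sum_eq_multiset_sum, Multiset.map_id', hP, hO] at h
    rw [Finset.sum_eq_multiset_sum, Multiset.map_id']
    simp only [Multiset.sum_add] at h ⊢
    omega
  · intro m
    simp only [plainCount, hP, Multiset.count_add]
    omega
  · intro m
    simp only [overCount, hO, Multiset.count_add]
    omega

/-- Two families of overpartitions that are matched by trading parts are equinumerous. -/
theorem card_eq_of_trade {P Q : ℕ → Overpartition n → Prop} (S T U V : ℕ → Multiset ℕ)
    (hP : ∀ s t π, P s π → P t π → s = t) (hQ : ∀ s t π, Q s π → Q t π → s = t)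
    (hS : ∀ s π, P s π → ∀ m, (S s).count m ≤ π.plainCount m)
    (hU : ∀ s π, P s π → ∀ m, (U s).count m ≤ π.overCount m)
    (hV : ∀ s π, P s π → ∀ m, π.overCount m + (V s).count m ≤ 1 + (U s).count m)
    (hT : ∀ s π, Q s π → ∀ m, (T s).count m ≤ π.plainCount m)
    (hV' : ∀ s π, Q s π → ∀ m, (V s).count m ≤ π.overCount m)
    (hU' : ∀ s π, Q s π → ∀ m, π.overCount m + (U s).count m ≤ 1 + (V s).count m)
    (h0 : ∀ s π, P s π → 0 ∉ T s ∧ 0 ∉ V s ∧ (S s).sum + (U s).sum = (T s).sum + (V s).sum)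
    (h0' : ∀ s π, Q s π → 0 ∉ S s ∧ 0 ∉ U s ∧ (S s).sum + (U s).sum = (T s).sum + (V s).sum)
    (hPQ : ∀ s π ρ, P s π → Trade (S s) (T s) (U s) (V s) π ρ → Q s ρ)
    (hQP : ∀ s π ρ, Q s ρ → Trade (S s) (T s) (U s) (V s) π ρ → P s π) :
    Nat.card {π : Overpartition n // ∃ s, P s π} = Nat.card {π : Overpartition n // ∃ s, Q s π} := by
  have hex : ∀ π : {π : Overpartition n // ∃ s, P s π}, ∃ ρ : {π : Overpartition n // ∃ s, Q s π},
      ∃ s, P s π.1 ∧ Q s ρ.1 ∧ Trade (S s) (T s) (U s) (V s) π.1 ρ.1 := by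
    rintro ⟨π, s, hs⟩
    obtain ⟨a, b, c⟩ := h0 s π hs
    obtain ⟨ρ, hρ⟩ := exists_trade (hS s π hs) (hU s π hs) (hV s π hs) a b c
    exact ⟨⟨ρ, s, hPQ s π ρ hs hρ⟩, s, hs, hPQ s π ρ hs hρ, hρ⟩
  choose f hf using hex
  refine Nat.card_eq_of_bijective f ⟨?_, ?_⟩
  -- The image determines the index s, hence which trade to reverse.
  · intro π π' h
    obtain ⟨s, -, q, t⟩ := hf π
    obtain ⟨s', -, q', t'⟩ := hf π'
    rw [← h] at q' t'
    obtain rfl := hQ _ _ _ q q'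
    exact Subtype.ext (t.symm.right_unique t'.symm)
  · rintro ⟨ρ, s, hs⟩
    obtain ⟨a, b, c⟩ := h0' s ρ hs
    obtain ⟨π, hπ⟩ := exists_trade (hT s ρ hs) (hV' s ρ hs) (hU' s ρ hs) a b c.symm
    refine ⟨⟨π, s, hQP s π ρ hs hπ.symm⟩, Subtype.ext ?_⟩
    obtain ⟨s', p', -, t'⟩ := hf ⟨π, s, hQP s π ρ hs hπ.symm⟩
    obtain rfl := hP _ _ _ (hQP s π ρ hs hπ.symm) p'
    exact t'.right_unique hπ.symm

theorem card_split {P Q R : Overpartition n → Prop} (h : ∀ π, P π ↔ Q π ∨ R π)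
    (hd : ∀ π, Q π → ¬ R π) :
    Nat.card {π // P π} = Nat.card {π // Q π} + Nat.card {π // R π} := by
  classical
  rw [← Nat.card_sum]
  refine Nat.card_congr ((Equiv.subtypeEquivRight h).trans (subtypeOrEquiv Q R ?_))
  exact Pi.disjoint_iff.mpr fun π => Prop.disjoint_iff.mpr fun hh => hd π hh.1 hh.2

/-- The number of overpartitions of `n` with at least `k` non-overlined parts equal to `k`. -/
noncomputable def plainSquareCount (n k : ℕ) : ℕ :=
  Nat.card {π : Overpartition n // k ≤ π.plainCount k}

theorem plainSquareCount_eq_zero {n k : ℕ} (h : n < k) : plainSquareCount n k = 0 := by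
  refine @Nat.card_of_isEmpty _ ⟨fun ⟨π, hπ⟩ => ?_⟩
  have := π.mul_plainCount_le k
  nlinarith

/-! ### Splitting the sets counted by `Mbar` and `Nbar` -/

theorem Mbar_iff (k : ℕ) (π : Overpartition n) :
    (∃ s, IsLeast {m : ℕ | k < m ∧ m ∈ π.toPartition.parts} s ∧ k + 1 ≤ π.mult s) ↔
      ∃ s, k < s ∧ π.Gap (k + 1) s ∧ k + 1 ≤ π.plainCount s + π.overCount s := by
  refine exists_congr fun s => ?_
  simp only [IsLeast, mem_lowerBounds, Set.mem_ofPred_eq, mem_parts_iff, mult_eq]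
  constructor
  · rintro ⟨⟨⟨h1, h2⟩, h3⟩, h4⟩
    refine ⟨h1, fun m hm hms => ?_, h4⟩
    by_contra hc
    have := h3 m ⟨hm, by omega⟩
    omega
  · rintro ⟨h1, h2, h3⟩
    refine ⟨⟨⟨h1, by omega⟩, fun m hm => ?_⟩, h3⟩
    by_contra hc
    have := h2 m hm.1 (by omega)
    omega

/-- The clauses `≠ k →` express that an overlined k is ignored. Since k ≥ 1, having k plain copies
already makes s a part. -/
theorem Nbar_iff (k : ℕ) (hk : 1 ≤ k) (π : Overpartition n) :
    (∃ s, IsLeast {m : ℕ | k ≤ m ∧ (m ∈ π.plain ∨ m ∈ π.overlined.erase k)} s ∧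
      π.plain.count s = k ∧ s ∉ π.overlined.erase k) ↔
      ∃ s, k ≤ s ∧ (∀ m, k ≤ m → m < s → π.plainCount m = 0 ∧ (m ≠ k → π.overCount m = 0)) ∧
        π.plainCount s = k ∧ (s ≠ k → π.overCount s = 0) := by
  refine exists_congr fun s => ?_
  simp only [IsLeast, mem_lowerBounds, Set.mem_ofPred_eq, mem_plain_iff, mem_overlined_iff,
    Finset.mem_erase, ← plainCount.eq_def]
  constructor
  · rintro ⟨⟨⟨h1, h2⟩, h3⟩, h4, h5⟩
    refine ⟨h1, fun m hm hms => ?_, h4, by omega⟩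
    by_contra hc
    have := h3 m ⟨hm, by omega⟩
    omega
  · rintro ⟨h1, h2, h3, h4⟩
    refine ⟨⟨⟨h1, by omega⟩, fun m hm => ?_⟩, h3, by omega⟩
    by_contra hc
    have := h2 m hm.1 (by omega)
    omega

theorem Gap.unique {a s t : ℕ} (hs : π.Gap a s) (ht : π.Gap a t) (has : a ≤ s) (hat : a ≤ t)
    (hs' : π.plainCount s ≠ 0 ∨ π.overCount s ≠ 0)
    (ht' : π.plainCount t ≠ 0 ∨ π.overCount t ≠ 0) : s = t := by
  rcases lt_trichotomy s t with h | h | h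
  · have := ht s has h
    omega
  · exact h
  · have := hs t hat h
    omega

/-! ### Bijections for relation (3) -/

/-- Making an overlined copy of the smallest part at least `k` plain. -/
theorem card_unmark (k : ℕ) (hk : 1 ≤ k) :
    Nat.card {π : Overpartition n // ∃ s, k ≤ s ∧ π.Gap k s ∧ π.plainCount s + 1 = k ∧
      π.overCount s = 1} =
    Nat.card {π : Overpartition n // ∃ s, k ≤ s ∧ π.Gap k s ∧ π.plainCount s = k ∧
      π.overCount s = 0 ∧ π.overCount k = 0} := by
  refine card_eq_of_trade (fun _ => 0) (fun s => {s}) (fun s => {s}) (fun _ => 0)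
    ?_ ?_ ?_ ?_ ?_ ?_ ?_ ?_ ?_ ?_ ?_ ?_
  · rintro s t π ⟨a, b, c, d⟩ ⟨a', b', c', d'⟩
    exact b.unique b' a a' (by omega) (by omega)
  · rintro s t π ⟨a, b, c, d⟩ ⟨a', b', c', d'⟩
    exact b.unique b' a a' (by omega) (by omega)
  · simp
  · rintro s π ⟨a, b, c, d⟩ m
    rw [Multiset.count_singleton]
    split_ifs with h
    · subst h; omega
    · omega
  · rintro s π ⟨a, b, c, d⟩ m
    have := π.overCount_le_one m
    simp only [Multiset.count_zero]
    omega
  · rintro s π ⟨a, b, c, d⟩ m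
    rw [Multiset.count_singleton]
    split_ifs with h
    · subst h; omega
    · omega
  · simp
  · rintro s π ⟨a, b, c, d, e⟩ m
    have := π.overCount_le_one m
    rw [Multiset.count_singleton]
    split_ifs with h
    · subst h; omega
    · simpa using this
  · rintro s π ⟨a, -⟩
    simp; omega
  · rintro s π ⟨a, -⟩
    simp; omega
  · rintro s π ρ ⟨a, b, c, d⟩ ⟨hp, ho⟩
    simp only [Multiset.count_singleton, Multiset.count_zero] at hp ho
    have h1 := hp s
    have h2 := ho s
    have h3 := ho k
    simp only [if_true] at h1 h2
    refine ⟨a, fun m hm hms => ?_, by omega, by omega, ?_⟩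
    · have h4 := hp m
      have h5 := ho m
      have h6 := b m hm hms
      rw [if_neg hms.ne] at h4 h5
      omega
    · rcases a.eq_or_lt with rfl | h
      · omega
      · have h6 := b k le_rfl h
        omega
  · rintro s π ρ ⟨a, b, c, d, e⟩ ⟨hp, ho⟩
    simp only [Multiset.count_singleton, Multiset.count_zero] at hp ho
    have h1 := hp s
    have h2 := ho s
    simp only [if_true] at h1 h2
    refine ⟨a, fun m hm hms => ?_, by omega, by omega⟩
    have h4 := hp m
    have h5 := ho m
    have h6 := b m hm hms
    rw [if_neg hms.ne] at h4 h5
    omega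

/-- Lowering `k` copies of the smallest part at least `k` by one and adding an overlined `k`. -/
theorem card_lower_mark (k : ℕ) (hk : 1 ≤ k) :
    Nat.card {π : Overpartition n // ∃ s, k ≤ s ∧ π.Gap k (s + 1) ∧ k ≤ π.plainCount (s + 1)} =
    Nat.card {π : Overpartition n // ∃ s, k ≤ s ∧
      (∀ m, k ≤ m → m < s → π.plainCount m = 0 ∧ (m ≠ k → π.overCount m = 0)) ∧
      π.plainCount s = k ∧ (s ≠ k → π.overCount s = 0) ∧ π.overCount k = 1} := by
  refine card_eq_of_trade (fun s => Multiset.replicate k (s + 1))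
    (fun s => Multiset.replicate k s) (fun _ => 0) (fun _ => {k})
    ?_ ?_ ?_ ?_ ?_ ?_ ?_ ?_ ?_ ?_ ?_ ?_
  · rintro s t π ⟨a, b, c⟩ ⟨a', b', c'⟩
    have := b.unique b' (by omega) (by omega) (by omega) (by omega)
    omega
  · rintro s t π ⟨a, b, c, d⟩ ⟨a', b', c', d'⟩
    rcases lt_trichotomy s t with h | h | h
    · have := b' s a h
      omega
    · exact h
    · have := b t a' h
      omega
  · rintro s π ⟨a, b, c⟩ m
    rw [Multiset.count_replicate]
    split_ifs with h
    · subst h; omega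
    · omega
  · simp
  · rintro s π ⟨a, b, c⟩ m
    have := π.overCount_le_one m
    -- The gap contains k because s ≥ k, so an overlined k is free to be added.
    have := b k le_rfl (by omega)
    simp only [Multiset.count_zero, Multiset.count_singleton]
    split_ifs with h
    · subst h; omega
    · omega
  · rintro s π ⟨a, b, c, d⟩ m
    rw [Multiset.count_replicate]
    split_ifs with h
    · subst h; omega
    · omega
  · rintro s π ⟨a, b, c, d, e⟩ m
    rw [Multiset.count_singleton]
    split_ifs with h
    · subst h; omega
    · omega
  · rintro s π ⟨a, b, c, d, e⟩ m
    have := π.overCount_le_one m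
    simp only [Multiset.count_zero]
    omega
  · rintro s π ⟨a, -⟩
    refine ⟨fun h => ?_, fun h => ?_, ?_⟩
    · have := Multiset.eq_of_mem_replicate h
      omega
    · have := Multiset.mem_singleton.mp h
      omega
    · simp [mul_add]
  · rintro s π ⟨a, -⟩
    refine ⟨fun h => ?_, by simp, ?_⟩
    · have := Multiset.eq_of_mem_replicate h
      omega
    · simp [mul_add]
  · rintro s π ρ ⟨a, b, c⟩ ⟨hp, ho⟩
    simp only [Multiset.count_replicate, Multiset.count_singleton, Multiset.count_zero] at hp ho
    -- The source has no parts in [k, s], so there the image has exactly the inserted parts; this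
    -- also covers s = k.
    have key : ∀ m, k ≤ m → m < s + 1 → ρ.plainCount m = (if s = m then k else 0) ∧
        ρ.overCount m = (if m = k then 1 else 0) := by
      intro m hm hms
      have h4 := hp m
      have h5 := ho m
      have h6 := b m hm hms
      rw [if_neg (by omega : ¬ s + 1 = m)] at h4
      omega
    refine ⟨a, fun m hm hms => ?_, ?_, fun h => ?_, ?_⟩
    · have := key m hm (by omega)
      rw [if_neg (by omega)] at this
      refine ⟨this.1, fun h => ?_⟩
      rw [this.2, if_neg h]
    · simp [(key s a (by omega)).1]
    · rw [(key s a (by omega)).2, if_neg h]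
    · simp [(key k le_rfl (by omega)).2]
  · rintro s π ρ ⟨a, b, c, d, e⟩ ⟨hp, ho⟩
    simp only [Multiset.count_replicate, Multiset.count_singleton, Multiset.count_zero] at hp ho
    refine ⟨a, fun m hm hms => ?_, ?_⟩
    · have h4 := hp m
      have h5 := ho m
      rw [if_neg (by omega : ¬ s + 1 = m)] at h4
      by_cases hs : m = s
      · subst hs
        by_cases hmk : m = k
        · subst hmk; simp at h4 h5; omega
        · simp [hmk] at h4 h5; have := d hmk; omega
      · have h6 := b m hm (by omega)
        rw [if_neg (Ne.symm hs)] at h4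
        by_cases hmk : m = k
        · subst hmk; simp at h5; omega
        · simp [hmk] at h5; have := h6.2 hmk; omega
    · have h4 := hp (s + 1)
      simp at h4
      omega

/-- The smallest part s above k has either k+1 plain copies with s = k+1, or k plain copies and an
overlined one, or k+1 plain copies with s > k+1. The first case gives a_{k+1}. The other two match
the members of N_{k+1} without and with an overlined k+1. -/
theorem Mbar_eq (n k : ℕ) : Mbar k n = plainSquareCount n (k + 1) + Nbar (k + 1) n := by
  have hN : Nbar (k + 1) n = _ :=
    Nat.card_congr (Equiv.subtypeEquivRight (Nbar_iff (n := n) (k + 1) (by omega)))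
  have hM : Mbar k n = _ := Nat.card_congr (Equiv.subtypeEquivRight (Mbar_iff (n := n) k))
  rw [hN, hM, plainSquareCount]
  rw [card_split (R := fun π : Overpartition n => (∃ s, k + 1 ≤ s ∧ π.Gap (k + 1) s ∧
        π.plainCount s + 1 = k + 1 ∧ π.overCount s = 1) ∨
        ∃ s, k + 1 ≤ s ∧ π.Gap (k + 1) (s + 1) ∧ k + 1 ≤ π.plainCount (s + 1))
      (Q := fun π => k + 1 ≤ π.plainCount (k + 1)), Nat.add_left_cancel_iff]
  · rw [card_split (fun π => Iff.rfl), card_unmark _ (by omega), card_lower_mark _ (by omega)]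
    · symm
      apply card_split
      · intro π
        have := π.overCount_le_one (k + 1)
        constructor
        · rintro ⟨s, a, b, c, d⟩
          rcases Nat.eq_zero_or_pos (π.overCount (k + 1)) with h | h
          · refine Or.inl ⟨s, a, fun m hm hms => ?_, c, ?_, h⟩
            · refine ⟨(b m hm hms).1, ?_⟩
              by_cases hmk : m = k + 1
              · rwa [hmk]
              · exact (b m hm hms).2 hmk
            · by_cases hmk : s = k + 1
              · rwa [hmk]
              · exact d hmk
          · exact Or.inr ⟨s, a, b, c, d, by omega⟩
        · rintro (⟨s, a, b, c, d, e⟩ | ⟨s, a, b, c, d, e⟩)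
          · exact ⟨s, a, fun m hm hms => ⟨(b m hm hms).1, fun _ => (b m hm hms).2⟩, c, fun _ => d⟩
          · exact ⟨s, a, b, c, d⟩
      · rintro π ⟨s, a, b, c, d, e⟩ ⟨s', a', b', c', d', e'⟩
        omega
    · rintro π ⟨s, a, b, c, d⟩ ⟨t, a', b', c'⟩
      have := b.unique b' a (by omega) (by omega) (by omega)
      subst this
      omega
  · intro π
    constructor
    · rintro ⟨s, a, b, c⟩
      have := π.overCount_le_one s
      by_cases h : k + 1 ≤ π.plainCount s
      · rcases (show k + 1 ≤ s from a).eq_or_lt with rfl | h'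
        · exact Or.inl h
        · obtain ⟨t, rfl⟩ : ∃ t, s = t + 1 := ⟨s - 1, by omega⟩
          exact Or.inr (Or.inr ⟨t, by omega, b, h⟩)
      · exact Or.inr (Or.inl ⟨s, a, b, by omega, by omega⟩)
    · rintro (h | ⟨s, a, b, c, d⟩ | ⟨s, a, b, c⟩)
      · exact ⟨k + 1, by omega, fun m h1 h2 => by omega, by omega⟩
      · exact ⟨s, a, b, by omega⟩
      · exact ⟨s + 1, by omega, b, by omega⟩
  · rintro π h (⟨s, a, b, c, d⟩ | ⟨s, a, b, c⟩)
    · rcases a.eq_or_lt with rfl | h'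
      · omega
      · have := b _ le_rfl h'
        omega
    · have := b (k + 1) le_rfl (by omega)
      omega

/-! ### Bijections for relation (2) -/

/-- Lowering `k` copies of the smallest part above `k` by one and adding a plain `k`. -/
theorem card_lower_plain (k : ℕ) (hk : 1 ≤ k) :
    Nat.card {π : Overpartition n // ∃ s, k < s ∧ π.Gap (k + 1) (s + 1) ∧
      k ≤ π.plainCount (s + 1)} =
    Nat.card {π : Overpartition n // ∃ s, k < s ∧ π.Gap (k + 1) s ∧
      π.plainCount s = k ∧ π.overCount s = 0 ∧ 1 ≤ π.plainCount k} := by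
  refine card_eq_of_trade (fun s => Multiset.replicate k (s + 1))
    (fun s => Multiset.replicate k s + {k}) (fun _ => 0) (fun _ => 0)
    ?_ ?_ ?_ ?_ ?_ ?_ ?_ ?_ ?_ ?_ ?_ ?_
  · rintro s t π ⟨a, b, c⟩ ⟨a', b', c'⟩
    have := b.unique b' (by omega) (by omega) (by omega) (by omega)
    omega
  · rintro s t π ⟨a, b, c, d⟩ ⟨a', b', c', d'⟩
    exact b.unique b' a a' (by omega) (by omega)
  · rintro s π ⟨a, b, c⟩ m
    rw [Multiset.count_replicate]
    split_ifs with h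
    · subst h; omega
    · omega
  · simp
  · rintro s π - m
    simpa using π.overCount_le_one m
  · rintro s π ⟨a, b, c, d, e⟩ m
    rw [Multiset.count_add, Multiset.count_replicate, Multiset.count_singleton]
    split_ifs with h h' h'
    · omega
    · subst h; omega
    · subst h'; omega
    · omega
  · simp
  · rintro s π - m
    simpa using π.overCount_le_one m
  · rintro s π ⟨a, -⟩
    refine ⟨fun h => ?_, by simp, ?_⟩
    · rcases Multiset.mem_add.mp h with h | h
      · have := Multiset.eq_of_mem_replicate h
        omega
      · have := Multiset.mem_singleton.mp h
        omega
    · simp [mul_add]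
  · rintro s π ⟨a, -⟩
    refine ⟨fun h => ?_, by simp, ?_⟩
    · have := Multiset.eq_of_mem_replicate h
      omega
    · simp [mul_add]
  · rintro s π ρ ⟨a, b, c⟩ ⟨hp, ho⟩
    simp only [Multiset.count_add, Multiset.count_replicate, Multiset.count_singleton,
      Multiset.count_zero] at hp ho
    refine ⟨a, fun m hm hms => ?_, ?_, ?_, ?_⟩
    · have h4 := hp m
      have h5 := ho m
      have h6 := b m hm (by omega)
      rw [if_neg (by omega), if_neg (by omega), if_neg (by omega)] at h4
      omega
    · have h4 := hp s
      have h6 := b s a (by omega)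
      rw [if_neg (by omega), if_pos rfl, if_neg (by omega)] at h4
      omega
    · have h5 := ho s
      have h6 := b s a (by omega)
      omega
    · have h4 := hp k
      rw [if_neg (by omega), if_neg (by omega), if_pos rfl] at h4
      omega
  · rintro s π ρ ⟨a, b, c, d, e⟩ ⟨hp, ho⟩
    simp only [Multiset.count_add, Multiset.count_replicate, Multiset.count_singleton,
      Multiset.count_zero] at hp ho
    refine ⟨a, fun m hm hms => ?_, ?_⟩
    · have h4 := hp m
      have h5 := ho m
      rw [if_neg (by omega), if_neg (by omega : ¬ m = k)] at h4
      by_cases hs : s = m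
      · subst hs
        rw [if_pos rfl] at h4
        omega
      · have h6 := b m hm (by omega)
        rw [if_neg hs] at h4
        omega
    · have h4 := hp (s + 1)
      rw [if_pos rfl, if_neg (by omega), if_neg (by omega)] at h4
      omega

/-- Trading one multiset of plain parts for another with the same sum. -/
theorem card_exchange (S T : Multiset ℕ) (hS : 0 ∉ S) (hT : 0 ∉ T) (h : S.sum = T.sum) :
    Nat.card {π : Overpartition n // S ≤ π.plain} =
      Nat.card {π : Overpartition n // T ≤ π.plain} := by
  -- The trade is fixed, so a dummy index s = 0 supplies the indexed form.
  have key : ∀ R : Multiset ℕ, Nat.card {π : Overpartition n // R ≤ π.plain} =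
      Nat.card {π : Overpartition n // ∃ s, s = 0 ∧ R ≤ π.plain} := fun R => by simp
  rw [key, key]
  refine card_eq_of_trade (fun _ => S) (fun _ => T) (fun _ => 0) (fun _ => 0)
    ?_ ?_ ?_ ?_ ?_ ?_ ?_ ?_ ?_ ?_ ?_ ?_
  · rintro s t π ⟨rfl, -⟩ ⟨rfl, -⟩; rfl
  · rintro s t π ⟨rfl, -⟩ ⟨rfl, -⟩; rfl
  · rintro s π ⟨-, h⟩ m
    exact Multiset.le_iff_count.mp h m
  · simp
  · rintro s π - m
    simpa using π.overCount_le_one m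
  · rintro s π ⟨-, h⟩ m
    exact Multiset.le_iff_count.mp h m
  · simp
  · rintro s π - m
    simpa using π.overCount_le_one m
  · simp [hT, h]
  · simp [hS, h]
  · rintro s π ρ ⟨h1, h2⟩ ⟨hp, -⟩
    refine ⟨h1, Multiset.le_iff_count.mpr fun m => ?_⟩
    have h3 := Multiset.le_iff_count.mp h2 m
    have h4 := hp m
    simp only [plainCount] at h4
    omega
  · rintro s π ρ ⟨h1, h2⟩ ⟨hp, -⟩
    refine ⟨h1, Multiset.le_iff_count.mpr fun m => ?_⟩
    have h3 := Multiset.le_iff_count.mp h2 m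
    have h4 := hp m
    simp only [plainCount] at h4
    omega

theorem card_le_plainCount (a b : ℕ) :
    Nat.card {π : Overpartition n // a ≤ π.plainCount b} =
      Nat.card {π : Overpartition n // Multiset.replicate a b ≤ π.plain} :=
  Nat.card_congr (Equiv.subtypeEquivRight fun _ => Multiset.le_count_iff_replicate_le)

/-- Let X count the overpartitions whose smallest part above k has at least k plain copies, and Y
those with exactly k and no overlined copy; split Y = Y₁ + Y₀ by whether a plain k is present. Then
X = M_k + Y, while splitting on s = k+1 and lowering otherwise gives X = #(k copies of k+1) + Y₁.
Hence M_k + Y₀ = #(k copies of k+1) = #(k+1 copies of k), and N_k = #(exactly k copies of k) + Y₀.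
-/
theorem Mbar_add_Nbar (n k : ℕ) (hk : 1 ≤ k) : Mbar k n + Nbar k n = plainSquareCount n k := by
  have hN : Nbar k n = _ := Nat.card_congr (Equiv.subtypeEquivRight (Nbar_iff (n := n) k hk))
  have hM : Mbar k n = _ := Nat.card_congr (Equiv.subtypeEquivRight (Mbar_iff (n := n) k))
  have hX : Nat.card {π : Overpartition n // ∃ s, k < s ∧ π.Gap (k + 1) s ∧
      k ≤ π.plainCount s} = Mbar k n + Nat.card {π : Overpartition n // ∃ s, k < s ∧
        π.Gap (k + 1) s ∧ π.plainCount s = k ∧ π.overCount s = 0} := by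
    rw [hM]
    apply card_split
    · intro π
      constructor
      · rintro ⟨s, a, b, c⟩
        by_cases h : k + 1 ≤ π.plainCount s + π.overCount s
        · exact Or.inl ⟨s, a, b, h⟩
        · exact Or.inr ⟨s, a, b, by omega, by omega⟩
      · rintro (⟨s, a, b, c⟩ | ⟨s, a, b, c, -⟩)
        · have := π.overCount_le_one s
          exact ⟨s, a, b, by omega⟩
        · exact ⟨s, a, b, c.ge⟩
    · rintro π ⟨s, a, b, c⟩ ⟨t, a', b', c', d'⟩
      have := b.unique b' a a' (by omega) (by omega)
      subst this
      omega
  have hX' : Nat.card {π : Overpartition n // ∃ s, k < s ∧ π.Gap (k + 1) s ∧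
      k ≤ π.plainCount s} = Nat.card {π : Overpartition n // k ≤ π.plainCount (k + 1)} +
        Nat.card {π : Overpartition n // ∃ s, k < s ∧ π.Gap (k + 1) (s + 1) ∧
          k ≤ π.plainCount (s + 1)} := by
    apply card_split
    · intro π
      constructor
      · rintro ⟨s, a, b, c⟩
        rcases (show k + 1 ≤ s from a).eq_or_lt with rfl | h'
        · exact Or.inl c
        · obtain ⟨t, rfl⟩ : ∃ t, s = t + 1 := ⟨s - 1, by omega⟩
          exact Or.inr ⟨t, by omega, b, c⟩
      · rintro (h | ⟨s, a, b, c⟩)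
        · exact ⟨k + 1, by omega, fun m h1 h2 => by omega, h⟩
        · exact ⟨s + 1, by omega, b, c⟩
    · rintro π h ⟨s, a, b, c⟩
      have := b (k + 1) le_rfl (by omega)
      omega
  have hY : Nat.card {π : Overpartition n // ∃ s, k < s ∧ π.Gap (k + 1) s ∧
      π.plainCount s = k ∧ π.overCount s = 0} =
      Nat.card {π : Overpartition n // ∃ s, k < s ∧ π.Gap (k + 1) s ∧
        π.plainCount s = k ∧ π.overCount s = 0 ∧ 1 ≤ π.plainCount k} +
      Nat.card {π : Overpartition n // ∃ s, k < s ∧ π.Gap (k + 1) s ∧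
        π.plainCount s = k ∧ π.overCount s = 0 ∧ π.plainCount k = 0} := by
    apply card_split
    · intro π
      constructor
      · rintro ⟨s, a, b, c, d⟩
        by_cases h : 1 ≤ π.plainCount k
        · exact Or.inl ⟨s, a, b, c, d, h⟩
        · exact Or.inr ⟨s, a, b, c, d, by omega⟩
      · rintro (⟨s, a, b, c, d, -⟩ | ⟨s, a, b, c, d, -⟩) <;> exact ⟨s, a, b, c, d⟩
    · rintro π ⟨s, a, b, c, d, e⟩ ⟨s', a', b', c', d', e'⟩
      omega
  have hN' : Nbar k n = Nat.card {π : Overpartition n // π.plainCount k = k} +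
      Nat.card {π : Overpartition n // ∃ s, k < s ∧ π.Gap (k + 1) s ∧
        π.plainCount s = k ∧ π.overCount s = 0 ∧ π.plainCount k = 0} := by
    rw [hN]
    apply card_split
    · intro π
      constructor
      · rintro ⟨s, a, b, c, d⟩
        rcases a.eq_or_lt with rfl | h
        · exact Or.inl c
        · refine Or.inr ⟨s, h, fun m h1 h2 => ?_, c, d h.ne', (b k le_rfl h).1⟩
          have := b m (by omega) h2
          exact ⟨this.1, this.2 (by omega)⟩
      · rintro (h | ⟨s, a, b, c, d, e⟩)
        · exact ⟨k, le_rfl, fun m h1 h2 => by omega, h, fun h => absurd rfl h⟩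
        · refine ⟨s, a.le, fun m h1 h2 => ?_, c, fun _ => d⟩
          rcases h1.eq_or_lt with rfl | h3
          · exact ⟨e, fun h => absurd rfl h⟩
          · exact ⟨(b m h3 h2).1, fun _ => (b m h3 h2).2⟩
    · rintro π h ⟨s, a, b, c, d, e⟩
      omega
  have hA : plainSquareCount n k = Nat.card {π : Overpartition n // π.plainCount k = k} +
      Nat.card {π : Overpartition n // k + 1 ≤ π.plainCount k} :=
    card_split (fun π => by omega) (fun π h => by omega)
  have hE : Nat.card {π : Overpartition n // k ≤ π.plainCount (k + 1)} =
      Nat.card {π : Overpartition n // k + 1 ≤ π.plainCount k} := by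
    rw [card_le_plainCount, card_le_plainCount]
    apply card_exchange
    · exact fun h => by have := Multiset.eq_of_mem_replicate h; omega
    · exact fun h => by have := Multiset.eq_of_mem_replicate h; omega
    · simp only [Multiset.sum_replicate, smul_eq_mul]
      ring
  have hL := card_lower_plain (n := n) k hk
  omega

/-! ### The minimal excludant and the recurrence -/

theorem le_mex_iff (k : ℕ) (π : Overpartition n) :
    2 * k + 1 ≤ mex 2 1 π ↔ (Multiset.range k).map (fun i => 2 * i + 1) ≤ π.plain := by
  have hl := isLeast_mex (A := 2) (by omega) 1 π
  have hnd : ((Multiset.range k).map (fun i => 2 * i + 1)).Nodup :=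
    (Multiset.nodup_range k).map (fun a b h => by simpa using h)
  rw [Multiset.le_iff_subset hnd]
  constructor
  · intro h m hm
    obtain ⟨i, hi, rfl⟩ := Multiset.mem_map.mp hm
    rw [Multiset.mem_range] at hi
    by_contra hc
    have := hl.2 ⟨by omega, by simp [Nat.ModEq, Nat.add_mod], hc⟩
    omega
  · intro h
    by_contra hc
    obtain ⟨h1, h2, h3⟩ := hl.1
    simp only [Nat.ModEq] at h2
    refine h3 (h (Multiset.mem_map.mpr ⟨mex 2 1 π / 2, ?_, ?_⟩))
    · rw [Multiset.mem_range]
      omega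
    · show 2 * (mex 2 1 π / 2) + 1 = mex 2 1 π
      omega

theorem sum_odds (k : ℕ) : ((Multiset.range k).map (fun i => 2 * i + 1)).sum = k * k := by
  induction k with
  | zero => simp
  | succ k ih =>
    rw [Multiset.range_succ, Multiset.map_cons, Multiset.sum_cons, ih]
    ring

theorem op21_add_op21_succ (n k : ℕ) (hk : 1 ≤ k) :
    op21 n k + op21 n (k + 1) = plainSquareCount n k := by
  rw [plainSquareCount, card_le_plainCount,
    card_exchange _ ((Multiset.range k).map (fun i => 2 * i + 1))]
  · rw [← Nat.card_congr (Equiv.subtypeEquivRight (le_mex_iff (n := n) k))]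
    symm
    apply card_split
    · intro π
      -- The mex is odd, so modulo 4 it is 2k+1 or 2k+3; in the latter class, being at least 2k+1
      -- forces at least 2k+3.
      have h := (isLeast_mex (A := 2) (by omega) 1 π).1.2.1
      simp only [Nat.ModEq] at h ⊢
      omega
    · intro π
      simp only [Nat.ModEq]
      omega
  · exact fun h => by have := Multiset.eq_of_mem_replicate h; omega
  · simp
  · rw [sum_odds]
    simp

theorem two_mul_op21_succ (n k : ℕ) : 2 * op21 n (k + 1) = Mbar k n := by
  have h1 := Mbar_eq n k
  have h2 := Mbar_add_Nbar n (k + 1) (by omega)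
  have h3 := op21_add_op21_succ n (k + 1) (by omega)
  -- For n ≤ k, a_{k+1} = 0 forces every term to vanish.
  by_cases h : n ≤ k
  · have := plainSquareCount_eq_zero (show n < k + 1 by omega)
    omega
  · have := two_mul_op21_succ n (k + 1)
    omega
termination_by n - k

end Overpartition

theorem mainTheorem5 (n k : ℕ) (hn : 1 ≤ n) (hk : 1 ≤ k) :
    (Overpartition.op21 n (k + 1) : ℚ) = (Overpartition.Mbar k n : ℚ) / 2 ∧
    (Overpartition.op21 n k : ℤ) - (Overpartition.op21 n (k + 1) : ℤ) =
      (Overpartition.Nbar k n : ℤ) := by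
  have h1 := Overpartition.two_mul_op21_succ n k
  have h2 := Overpartition.Mbar_add_Nbar n k hk
  have h3 := Overpartition.op21_add_op21_succ n k hk
  constructor
  · rw [← h1]
    push_cast
    ring
  · omega
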